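/- Let $\Phi$ be a homogeneous Poisson point process of intensity $\lambda>0$ on $\mathbb R^3$. For $X\in\Phi$ let $\mathcal V_X=\{z\in\mathbb R^3:\|z-X\|\le\|z-Y\|\text{ for all }Y\in\Phi\}$ be its Voronoi cell. A pair of distinct points $X,Y\in\Phi$ is called a Delaunay pair if $\mathcal V_X\cap\mathcal V_Y$ is two-dimensional; $\mathcal V_X\cap\mathcal V_Y$ is then the Voronoi facet of the pair. Let $\Xi=\Xi(\Phi)$ be the set of the midpoints $\frac{X+Y}2$ of those Delaunay pairs $X,Y$ for which $\frac{X+Y}2\in\mathcal V_X\cap\mathcal V_Y$, and write $\Xi(B)$ for the number of its points in $B$. Let $\mathbb P^0_\Phi$ be the Palm probability of $\Phi$, i.e. the law on locally finite configurations given by $$\mathbb P^0_\Phi(A)=\frac1\lambda\,\mathbb E\Big[\sum_{X\in\Phi\cap[0,1)^3}\mathbf 1_A(\Phi-X)\Big],$$ under which $0$ is a.s. a point of the configuration, and let $\mathcal V_0$ be the (typical) Voronoi cell of the nucleus $0$ under $\mathbb P^0_\Phi$. Then $\Xi(\mathcal V_0)$ is measurable with respect to the completion of $\mathbb P^0_\Phi$,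 and $$N_\pi:=\mathbb E^0_\Phi\big[\Xi(\mathcal V_0)\big]=8 .$$ -/

import Mathlib

open MeasureTheory ProbabilityTheory
open scoped ENNReal NNReal

/-- Three-dimensional Euclidean space. -/
abbrev E3 : Type := EuclideanSpace ℝ (Fin 3)

/-- Locally finite sets of points of `ℝ³`: the realizations of simple point processes. -/
def PointConfig : Type :=
  {φ : Set E3 // ∀ B : Set E3, Bornology.IsBounded B → (φ ∩ B).Finite}

namespace PointConfig

/-- The underlying set of points. -/
def points (φ : PointConfig) : Set E3 := φ.1

/-- The number `φ(B)` of points of `φ` in `B`. -/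
noncomputable def count (φ : PointConfig) (B : Set E3) : ℕ∞ := (φ.points ∩ B).encard

/-- The σ-algebra generated by the counting maps `φ ↦ φ(B)`, `B` a Borel set. -/
noncomputable instance : MeasurableSpace PointConfig :=
  ⨆ (B : Set E3) (_ : MeasurableSet B),
    MeasurableSpace.comap (fun φ : PointConfig => φ.count B) inferInstance

/-- The translate `φ - x = {y | y + x ∈ φ}` of `φ`, which brings `x` to the origin. -/
def shift (x : E3) (φ : PointConfig) : PointConfig :=
  ⟨{y | y + x ∈ φ.points}, fun B hB => by
    have h : ((fun y : E3 => y + x) '' ({y | y + x ∈ φ.points} ∩ B)).Finite := by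
      refine (φ.2 ((fun y : E3 => y + x) '' B) ?_).subset ?_
      · exact (LipschitzWith.of_dist_le_mul (K := 1) (fun a b => by simp)).isBounded_image hB
      · rintro _ ⟨y, ⟨hy, hyB⟩, rfl⟩
        exact ⟨hy, y, hyB, rfl⟩
    exact h.of_finite_image (fun a _ b _ hab => by simpa using hab)⟩

/-- The (closed) Voronoi cell of the nucleus `X` in the configuration `φ`. -/
def voronoiCell (φ : PointConfig) (X : E3) : Set E3 :=
  {z | ∀ Y ∈ φ.points, dist z X ≤ dist z Y}

/-- The common boundary of the Voronoi cells of `X` and `Y`. -/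
def voronoiFacet (φ : PointConfig) (X Y : E3) : Set E3 :=
  φ.voronoiCell X ∩ φ.voronoiCell Y

/-- Two distinct points of `φ` form a Delaunay pair when their Voronoi cells share a
two-dimensional facet, that is, when the common boundary spans an affine plane. -/
def IsDelaunayPair (φ : PointConfig) (X Y : E3) : Prop :=
  X ∈ φ.points ∧ Y ∈ φ.points ∧ X ≠ Y ∧
    Module.finrank ℝ (vectorSpan ℝ (φ.voronoiFacet X Y)) = 2

/-- The set `Ξ` of the midpoints of Delaunay pairs that lie on the Voronoi facet of the pair. -/
def facetMidpoints (φ : PointConfig) : Set E3 :=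
  {z | ∃ X Y : E3, φ.IsDelaunayPair X Y ∧ z = midpoint ℝ X Y ∧ z ∈ φ.voronoiFacet X Y}

/-- The number `Ξ(V₀)` of points of `Ξ` in the Voronoi cell of the nucleus `0`. -/
noncomputable def midpointsInZeroCell (φ : PointConfig) : ℕ∞ :=
  (φ.facetMidpoints ∩ φ.voronoiCell 0).encard

end PointConfig

/-- `Φ` is a homogeneous Poisson point process of intensity `r` on `ℝ³`: the number of points in
a bounded Borel set `B` is Poisson with parameter `r * volume B`, and the numbers of points in
pairwise disjoint bounded Borel sets are independent. -/
structure IsPoissonPointProcess {Ω : Type*} [MeasurableSpace Ω] (P : Measure Ω)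
    (r : ℝ≥0) (Φ : Ω → PointConfig) : Prop where
  measurable : Measurable Φ
  count_law : ∀ B : Set E3, MeasurableSet B → Bornology.IsBounded B →
    HasLaw (fun ω => (Φ ω).count B)
      ((poissonMeasure (r * (volume B).toNNReal)).map (fun n : ℕ => (n : ℕ∞))) P
  indep : ∀ (n : ℕ) (B : Fin n → Set E3), (∀ i, MeasurableSet (B i)) →
    (∀ i, Bornology.IsBounded (B i)) → Pairwise (fun i j => Disjoint (B i) (B j)) →
    iIndepFun (fun i ω => (Φ ω).count (B i)) P

/-- The unit cube `[0,1)³`. -/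
def unitCube : Set E3 := {x | ∀ i, x i ∈ Set.Ico (0 : ℝ) 1}

/-- The intensity of a stationary point process: the mean number of points in the unit cube. -/
noncomputable def ppIntensity {Ω : Type*} [MeasurableSpace Ω] (P : Measure Ω)
    (Φ : Ω → PointConfig) : ℝ≥0∞ :=
  ∫⁻ ω, ((Φ ω).count unitCube : ℝ≥0∞) ∂P

/-- The Palm probability of a stationary point process `Φ` of intensity `γ`, as a measure on
configurations: `A ↦ γ⁻¹ * E [∑_{X ∈ Φ ∩ [0,1)³} 1_A (Φ - X)]`. -/
noncomputable def palmMeasure {Ω : Type*} [MeasurableSpace Ω] (P : Measure Ω)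
    (Φ : Ω → PointConfig) : Measure PointConfig :=
  (ppIntensity P Φ)⁻¹ •
    P.bind (fun ω => Measure.sum (fun X : ↥((Φ ω).points ∩ unitCube) =>
      Measure.dirac ((Φ ω).shift (X : E3))))

/-! Call `Y` a Gabriel neighbour of `X` when the open ball with diameter `XY` contains no point of
the configuration. Almost surely no point sees two others under a right angle, and then the
midpoints in the cell of `0` correspond bijectively to the Gabriel neighbours of `0`. Indeed, by
Thales, a midpoint of `X, Y` lying on their facet and also in the cell of a third point would give
that point a right angle. Conversely, if the diametral ball is empty and no third point lies on its
boundary, the facet contains a planar neighbourhood of the midpoint, so the pair is Delaunay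
(`facetMidpoints_inter_voronoiCell`).

The mean number of Gabriel neighbours comes from Mecke's formula,
`lintegral_lintegral_pointMeasure`. Applied to the nucleus, it turns the Palm mean into the mean for
an added point. Applied to the neighbour, it yields `r ∫ exp(-r π ‖y‖³ / 6) dy`, since a ball of
diameter `d` has volume `π d³ / 6`. This integral is `r · (4π/3) / (r π / 6) = 8`. Mecke's formula
also excludes right angles: the apex must avoid countably many spheres.

The Gabriel count is measurable, which gives the a.e. measurability of the midpoint count. -/

namespace PointConfig

/-! ### Configurations as counting measures; measurability -/

theorem finite_inter (φ : PointConfig) {B : Set E3} (hB : Bornology.IsBounded B) :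
    (φ.points ∩ B).Finite := φ.2 B hB

theorem countable_points (φ : PointConfig) : φ.points.Countable := by
  have h : φ.points = ⋃ n : ℕ, φ.points ∩ Metric.ball 0 n := by
    rw [← Set.inter_iUnion, Metric.iUnion_ball_nat, Set.inter_univ]
  rw [h]
  exact Set.countable_iUnion fun n => (φ.finite_inter Metric.isBounded_ball).countable

theorem measurableSet_points (φ : PointConfig) : MeasurableSet φ.points :=
  φ.countable_points.measurableSet

/-- The counting measure carried by a configuration. -/
noncomputable def pointMeasure (φ : PointConfig) : Measure E3 :=
  Measure.count.restrict φ.points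

theorem pointMeasure_apply (φ : PointConfig) {B : Set E3} (hB : MeasurableSet B) :
    φ.pointMeasure B = (φ.count B : ℝ≥0∞) := by
  rw [pointMeasure, Measure.restrict_apply hB,
    Measure.count_apply (hB.inter φ.measurableSet_points), Set.inter_comm, count]

theorem setLIntegral_pointMeasure (φ : PointConfig) (f : E3 → ℝ≥0∞) {B : Set E3}
    (hB : MeasurableSet B) :
    ∫⁻ x in B, f x ∂φ.pointMeasure = ∑' x : ↥(φ.points ∩ B), f x := by
  rw [pointMeasure, Measure.restrict_restrict hB, Set.inter_comm,
    lintegral_countable _ (φ.countable_points.mono Set.inter_subset_left)]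
  simp

theorem lintegral_pointMeasure (φ : PointConfig) (f : E3 → ℝ≥0∞) :
    ∫⁻ x, f x ∂φ.pointMeasure = ∑' x : ↥φ.points, f x := by
  rw [pointMeasure, lintegral_countable _ φ.countable_points]
  simp

theorem lintegral_pointMeasure_eq_zero (φ : PointConfig) (f : E3 → ℝ≥0∞) :
    ∫⁻ x, f x ∂φ.pointMeasure = 0 ↔ ∀ x ∈ φ.points, f x = 0 := by
  rw [lintegral_pointMeasure, ENNReal.tsum_eq_zero]
  simp

theorem measurable_count {B : Set E3} (hB : MeasurableSet B) :
    Measurable fun φ : PointConfig => φ.count B := by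
  refine Measurable.mono (comap_measurable _) ?_ le_rfl
  exact le_iSup₂_of_le (f := fun (B : Set E3) (_ : MeasurableSet B) =>
    MeasurableSpace.comap (fun φ : PointConfig => φ.count B) inferInstance) B hB le_rfl

theorem measurable_of_count {α : Type*} [MeasurableSpace α] {f : α → PointConfig}
    (h : ∀ B, MeasurableSet B → Measurable fun a => (f a).count B) : Measurable f := by
  rw [measurable_iff_comap_le]
  simp only [instMeasurableSpace, MeasurableSpace.comap_iSup, MeasurableSpace.comap_comp]
  exact iSup₂_le fun B hB => (h B hB).comap_le

theorem measurable_of_toENNReal {α : Type*} [MeasurableSpace α] {f : α → ℕ∞}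
    (h : Measurable fun a => (f a : ℝ≥0∞)) : Measurable f := by
  refine measurable_to_countable' fun n => ?_
  have : f ⁻¹' {n} = (fun a => (f a : ℝ≥0∞)) ⁻¹' {(n : ℝ≥0∞)} := by
    ext a; simp
  rw [this]
  exact h (measurableSet_singleton _)

theorem measurable_pointMeasure : Measurable pointMeasure := by
  refine Measure.measurable_of_measurable_coe _ fun B hB => ?_
  simp_rw [pointMeasure_apply _ hB]
  exact (Measurable.of_discrete (f := fun n : ℕ∞ => (n : ℝ≥0∞))).comp (measurable_count hB)

/-- The kernel which sends a configuration to its counting measure. -/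
noncomputable def pointKernel : Kernel PointConfig E3 := ⟨pointMeasure, measurable_pointMeasure⟩

theorem pointKernel_apply (φ : PointConfig) : pointKernel φ = φ.pointMeasure := rfl

/-- The points whose norm has integer part `n`. -/
def normShell (n : ℕ) : Set E3 := {x | ⌊‖x‖⌋₊ = n}

theorem measurableSet_normShell (n : ℕ) : MeasurableSet (normShell n) :=
  (Nat.measurable_floor.comp measurable_norm) (measurableSet_singleton n)

theorem isBounded_normShell (n : ℕ) : Bornology.IsBounded (normShell n) := by
  refine (Metric.isBounded_ball (x := (0 : E3)) (r := n + 1)).subset fun x hx => ?_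
  have hx : ⌊‖x‖⌋₊ = n := hx
  rw [mem_ball_zero_iff, ← hx]
  exact Nat.lt_floor_add_one _

theorem count_ne_top (φ : PointConfig) {B : Set E3} (hB : Bornology.IsBounded B) :
    φ.count B ≠ ⊤ := by
  rw [count, Set.encard_ne_top_iff]
  exact φ.finite_inter hB

-- S-finiteness is what makes integrals of parametrized functions against the points measurable. A
-- bounded shell can hold arbitrarily many points, so the kernel is cut further according to the
-- exact number `k` of points in the shell; each piece has total mass at most `k`.
open Classical in
instance : IsSFiniteKernel pointKernel := by
  have hm : ∀ p : ℕ × ℕ, MeasurableSet {φ : PointConfig | φ.count (normShell p.1) = p.2} :=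
    fun p => measurable_count (measurableSet_normShell p.1) (measurableSet_singleton _)
  have hs : pointKernel = Kernel.sum fun p : ℕ × ℕ =>
      Kernel.piecewise (hm p) (pointKernel.restrict (measurableSet_normShell p.1)) 0 := by
    ext φ B hB
    rw [Kernel.sum_apply' _ _ hB, ENNReal.tsum_prod']
    have h1 : ∀ n k : ℕ,
        Kernel.piecewise (hm (n, k)) (pointKernel.restrict (measurableSet_normShell n)) 0 φ B =
          if k = (φ.count (normShell n)).toNat then φ.pointMeasure (B ∩ normShell n) else 0 := by
      intro n k
      have hk : k = (φ.count (normShell n)).toNat ↔ φ.count (normShell n) = k := by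
        obtain ⟨m, hm⟩ := ENat.ne_top_iff_exists.1 (φ.count_ne_top (isBounded_normShell n))
        rw [← hm]
        simp [eq_comm]
      rw [Kernel.piecewise_apply]
      simp only [Set.mem_ofPred_eq, hk]
      split_ifs
      · rw [Kernel.restrict_apply' _ _ _ hB, pointKernel_apply]
      · simp
    simp_rw [h1, tsum_ite_eq]
    rw [← measure_iUnion, ← Set.inter_iUnion, pointKernel_apply]
    · congr 1
      have : (⋃ n, normShell n) = Set.univ := Set.eq_univ_of_forall fun x =>
        Set.mem_iUnion.2 ⟨_, rfl⟩
      rw [this, Set.inter_univ]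
    · intro n m hnm
      refine Set.disjoint_left.2 fun x hx hx' => hnm ?_
      exact hx.2.symm.trans hx'.2
    · exact fun n => hB.inter (measurableSet_normShell n)
  rw [hs]
  refine @Kernel.isSFiniteKernel_sum _ _ _ _ _ _ _ fun p => ?_
  refine @Kernel.IsFiniteKernel.isSFiniteKernel _ _ _ _ _ ⟨⟨p.2, by simp, fun φ => ?_⟩⟩
  rw [Kernel.piecewise_apply]
  split_ifs with h
  · have h : φ.count (normShell p.1) = p.2 := h
    rw [Kernel.restrict_apply' _ _ _ MeasurableSet.univ, Set.univ_inter, pointKernel_apply,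
      pointMeasure_apply _ (measurableSet_normShell _), h]
    simp
  · simp

theorem measurable_lintegral_pointMeasure {α : Type*} [MeasurableSpace α] {c : α → PointConfig}
    (hc : Measurable c) {f : α → E3 → ℝ≥0∞} (hf : Measurable (Function.uncurry f)) :
    Measurable fun a => ∫⁻ x, f a x ∂(c a).pointMeasure :=
  Measurable.lintegral_kernel_prod_right (κ := pointKernel.comap c hc) hf

theorem measurable_pointMeasure_apply {α : Type*} [MeasurableSpace α] {c : α → PointConfig}
    (hc : Measurable c) {s : α → Set E3} (hs : MeasurableSet {p : α × E3 | p.2 ∈ s p.1}) :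
    Measurable fun a => (c a).pointMeasure (s a) :=
  Kernel.measurable_kernel_prodMk_left (κ := pointKernel.comap c hc) hs

theorem measurable_count_of {α : Type*} [MeasurableSpace α] {c : α → PointConfig}
    (hc : Measurable c) {s : α → Set E3} (hs : MeasurableSet {p : α × E3 | p.2 ∈ s p.1}) :
    Measurable fun a => (c a).count (s a) := by
  refine measurable_of_toENNReal ?_
  have h : ∀ a, MeasurableSet (s a) := fun a => measurable_prodMk_left (x := a) hs
  simp_rw [← pointMeasure_apply _ (h _)]
  exact measurable_pointMeasure_apply hc hs

theorem mem_points_shift {x y : E3} {φ : PointConfig} :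
    y ∈ (φ.shift x).points ↔ y + x ∈ φ.points := Iff.rfl

theorem count_shift (x : E3) (φ : PointConfig) (B : Set E3) :
    (φ.shift x).count B = φ.count {y | y - x ∈ B} := by
  rw [count, count, ← (add_left_injective x).encard_image]
  congr 1
  ext y
  constructor
  · rintro ⟨z, ⟨hz, hzB⟩, rfl⟩
    exact ⟨hz, by simpa using hzB⟩
  · rintro ⟨hy, hyB⟩
    exact ⟨y - x, ⟨by rw [mem_points_shift]; simpa using hy, hyB⟩, by simp⟩

theorem measurable_shift : Measurable fun p : E3 × PointConfig => p.2.shift p.1 := by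
  refine measurable_of_count fun B hB => ?_
  simp_rw [count_shift]
  refine measurable_count_of measurable_snd ?_
  exact (measurable_snd.sub (measurable_fst.comp measurable_fst)) hB

/-- The configuration `φ ∪ {x}`. -/
def insertPoint (x : E3) (φ : PointConfig) : PointConfig :=
  ⟨insert x φ.points, fun B hB => ((φ.finite_inter hB).insert x).subset (by
    rintro y ⟨rfl | hy, hyB⟩
    · exact Set.mem_insert _ _
    · exact Set.mem_insert_of_mem _ ⟨hy, hyB⟩)⟩

theorem mem_points_insertPoint {x y : E3} {φ : PointConfig} :
    y ∈ (φ.insertPoint x).points ↔ y = x ∨ y ∈ φ.points := Iff.rfl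

/-- The point `x` may already belong to `φ`; removing it from the first term prevents double
counting. -/
theorem pointMeasure_insertPoint (x : E3) (φ : PointConfig) {B : Set E3} (hB : MeasurableSet B) :
    (φ.insertPoint x).pointMeasure B = φ.pointMeasure (B ∩ {x}ᶜ) + B.indicator 1 x := by
  rw [← measure_inter_add_sdiff B (measurableSet_singleton x), add_comm]
  rw [pointMeasure, pointMeasure,
    Measure.restrict_apply (hB.diff (measurableSet_singleton x)),
    Measure.restrict_apply (hB.inter (measurableSet_singleton x).compl),
    Measure.restrict_apply (hB.inter (measurableSet_singleton x))]
  congr 2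
  · ext y
    simp only [Set.mem_inter_iff, Set.mem_sdiff, Set.mem_singleton_iff, Set.mem_compl_iff,
      mem_points_insertPoint]
    tauto
  · by_cases hx : x ∈ B
    · have : B ∩ {x} ∩ (φ.insertPoint x).points = {x} := by
        ext y
        simp only [Set.mem_inter_iff, Set.mem_singleton_iff, mem_points_insertPoint]
        constructor
        · tauto
        · rintro rfl; tauto
      rw [this]
      simp [hx]
    · have : B ∩ {x} ∩ (φ.insertPoint x).points = ∅ := by
        ext y
        simp only [Set.mem_inter_iff, Set.mem_singleton_iff, Set.mem_empty_iff_false, iff_false]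
        rintro ⟨⟨h, rfl⟩, -⟩
        exact hx h
      rw [this]
      simp [hx]

theorem measurable_insertPoint :
    Measurable fun p : E3 × PointConfig => p.2.insertPoint p.1 := by
  refine measurable_of_count fun B hB => measurable_of_toENNReal ?_
  simp_rw [← pointMeasure_apply _ hB, pointMeasure_insertPoint _ _ hB]
  refine Measurable.add (measurable_pointMeasure_apply measurable_snd ?_)
    ((measurable_one.indicator hB).comp measurable_fst)
  refine (measurable_snd hB).inter ?_
  exact (measurableSet_eq_fun measurable_snd (measurable_fst.comp measurable_fst)).compl

end PointConfig

/-! ### Void events generate the σ-algebra -/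

namespace PointConfig

theorem count_eq_zero {φ : PointConfig} {C : Set E3} :
    φ.count C = 0 ↔ ∀ x ∈ φ.points, x ∉ C := by
  rw [count, Set.encard_eq_zero, Set.eq_empty_iff_forall_notMem]
  exact ⟨fun h x hx hC => h x ⟨hx, hC⟩, fun h x hx => h x hx.1 hx.2⟩

/-- The events that a bounded Borel set contains no point. -/
def voidEvents : Set (Set PointConfig) :=
  {A | ∃ C : Set E3, MeasurableSet C ∧ Bornology.IsBounded C ∧ A = {φ | φ.count C = 0}}

theorem isPiSystem_voidEvents : IsPiSystem voidEvents := by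
  rintro _ ⟨C, hC, hCb, rfl⟩ _ ⟨D, hD, hDb, rfl⟩ -
  refine ⟨C ∪ D, hC.union hD, hCb.union hDb, ?_⟩
  ext φ
  simp only [Set.mem_inter_iff, Set.mem_ofPred_eq, count_eq_zero, Set.mem_union, not_or]
  exact ⟨fun h x hx => ⟨h.1 x hx, h.2 x hx⟩, fun h => ⟨fun x hx => (h x hx).1, fun x hx => (h x hx).2⟩⟩

/-- Finitely many points can be separated by disjoint sets of a countable basis. This writes a lower
bound on a count as a countable union of events determined by void events. -/
theorem le_count_iff {φ : PointConfig} {B : Set E3} {n : ℕ} :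
    (n : ℕ∞) ≤ φ.count B ↔ ∃ s : Fin n → TopologicalSpace.countableBasis E3,
      (Pairwise fun i j => Disjoint (s i : Set E3) (s j)) ∧ ∀ i, φ.count (B ∩ s i) ≠ 0 := by
  constructor
  · intro h
    obtain ⟨t, ht, htn⟩ := Set.exists_subset_encard_eq h
    have htf : t.Finite := Set.finite_of_encard_eq_coe htn
    obtain ⟨U, hU, hd⟩ := htf.t2_separation
    have hcard : htf.toFinset.card = n := by
      rw [htf.encard_eq_coe_toFinset_card] at htn
      exact_mod_cast htn
    let e := (htf.toFinset.equivFinOfCardEq hcard).symm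
    have he : ∀ i, (e i : E3) ∈ t := fun i => htf.mem_toFinset.1 (e i).2
    choose V hV hxV hVU using fun i => (TopologicalSpace.isBasis_countableBasis E3).exists_subset_of_mem_open
      (hU (e i)).1 (hU (e i)).2
    refine ⟨fun i => ⟨V i, hV i⟩, fun i j hij => ?_, fun i h0 => ?_⟩
    · refine (hd (he i) (he j) fun h => hij ?_).mono (hVU i) (hVU j)
      exact e.injective (Subtype.ext h)
    · exact count_eq_zero.1 h0 (e i) (ht (he i)).1 ⟨(ht (he i)).2, hxV i⟩
  · rintro ⟨s, hd, hs⟩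
    have : ∀ i, ∃ x ∈ φ.points, x ∈ B ∩ s i := fun i => by
      by_contra! h
      exact hs i (count_eq_zero.2 h)
    choose x hx hxs using this
    have hinj : Function.Injective x := fun i j hij => by
      by_contra hne
      exact Set.disjoint_left.1 (hd hne) (hxs i).2 (hij ▸ (hxs j).2)
    have h1 : (Set.range x).encard = n := by
      rw [← Set.image_univ, hinj.encard_image]
      simp
    rw [← h1, count]
    refine Set.encard_le_encard ?_
    rintro _ ⟨i, rfl⟩
    exact ⟨hx i, (hxs i).1⟩

theorem measurable_count_voidEvents {B : Set E3} (hB : MeasurableSet B) :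
    Measurable[MeasurableSpace.generateFrom voidEvents] fun φ : PointConfig => φ.count B := by
  have hvoid : ∀ C, MeasurableSet C →
      MeasurableSet[MeasurableSpace.generateFrom voidEvents] {φ : PointConfig | φ.count C = 0} := by
    intro C hC
    have : {φ : PointConfig | φ.count C = 0} =
        ⋂ n : ℕ, {φ : PointConfig | φ.count (C ∩ Metric.ball 0 n) = 0} := by
      ext φ
      simp only [Set.mem_ofPred_eq, Set.mem_iInter, count_eq_zero]
      refine ⟨fun h n x hx hxC => h x hx hxC.1, fun h x hx hxC => ?_⟩
      obtain ⟨n, hn⟩ := exists_nat_gt ‖x‖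
      exact h n x hx ⟨hxC, mem_ball_zero_iff.2 hn⟩
    rw [this]
    exact MeasurableSet.iInter fun n => MeasurableSpace.measurableSet_generateFrom
      ⟨_, hC.inter measurableSet_ball, Metric.isBounded_ball.subset Set.inter_subset_right, rfl⟩
  have hle : ∀ n : ℕ, MeasurableSet[MeasurableSpace.generateFrom voidEvents]
      {φ : PointConfig | (n : ℕ∞) ≤ φ.count B} := by
    intro n
    have : {φ : PointConfig | (n : ℕ∞) ≤ φ.count B} =
        ⋃ s : Fin n → TopologicalSpace.countableBasis E3,
          ⋃ _ : Pairwise fun i j => Disjoint (s i : Set E3) (s j),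
            ⋂ i, {φ : PointConfig | φ.count (B ∩ s i) = 0}ᶜ := by
      ext φ
      simp [le_count_iff]
    rw [this]
    have : Countable (TopologicalSpace.countableBasis E3) :=
      (TopologicalSpace.countable_countableBasis E3).to_subtype
    refine MeasurableSet.iUnion fun s => MeasurableSet.iUnion fun _ => MeasurableSet.iInter fun i =>
      (hvoid _ (hB.inter ?_)).compl
    exact (TopologicalSpace.isOpen_of_mem_countableBasis (s i).2).measurableSet
  refine (@ENat.measurable_iff _ (MeasurableSpace.generateFrom voidEvents) _).2 fun n => ?_
  have : (fun φ : PointConfig => φ.count B) ⁻¹' {(n : ℕ∞)} =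
      {φ | (n : ℕ∞) ≤ φ.count B} \ {φ | ((n + 1 : ℕ) : ℕ∞) ≤ φ.count B} := by
    ext φ
    simp only [Set.mem_preimage, Set.mem_singleton_iff, Set.mem_sdiff, Set.mem_ofPred_eq, not_le]
    push_cast
    rw [ENat.lt_natCast_add_one_iff]
    exact ⟨fun h => ⟨h.ge, h.le⟩, fun h => le_antisymm h.2 h.1⟩
  rw [this]
  exact (hle n).diff (hle (n + 1))

theorem generateFrom_voidEvents :
    MeasurableSpace.generateFrom voidEvents = (inferInstance : MeasurableSpace PointConfig) := by
  refine le_antisymm (MeasurableSpace.generateFrom_le ?_) ?_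
  · rintro _ ⟨C, hC, -, rfl⟩
    exact measurable_count hC (measurableSet_singleton 0)
  · exact iSup₂_le fun B hB => (measurable_count_voidEvents hB).comap_le

end PointConfig

/-! ### Poisson counts and Mecke's formula -/

theorem lintegral_natCast_poissonMeasure (m : ℝ≥0) :
    ∫⁻ n, (n : ℝ≥0∞) ∂poissonMeasure m = m := by
  have h1 : ∑' n : ℕ, ENNReal.ofReal (Real.exp (-m) * (m : ℝ) ^ n / n.factorial) = 1 := by
    have h := measure_univ (μ := poissonMeasure m)
    rw [poissonMeasure, Measure.sum_apply _ MeasurableSet.univ] at h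
    simpa using h
  rw [poissonMeasure, lintegral_sum_measure]
  simp_rw [lintegral_smul_measure, lintegral_dirac, smul_eq_mul]
  -- The term `n = 0` vanishes, and `(n + 1) / (n + 1)! = 1 / n!` reduces the rest to `m` times the
  -- total mass.
  rw [tsum_eq_zero_add' ENNReal.summable]
  have h2 : ∀ n : ℕ, ENNReal.ofReal (Real.exp (-m) * (m : ℝ) ^ (n + 1) / (n + 1).factorial) *
      ((n + 1 : ℕ) : ℝ≥0∞) =
      m * ENNReal.ofReal (Real.exp (-m) * (m : ℝ) ^ n / n.factorial) := by
    intro n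
    rw [← ENNReal.ofReal_natCast, ← ENNReal.ofReal_coe_nnreal, ← ENNReal.ofReal_mul (by positivity),
      ← ENNReal.ofReal_mul (by positivity), Nat.factorial_succ]
    congr 1
    push_cast
    field_simp
    ring
  simp_rw [h2, ENNReal.tsum_mul_left, h1]
  simp

namespace IsPoissonPointProcess

open PointConfig

variable {Ω : Type*} [MeasurableSpace Ω] {P : Measure Ω} {r : ℝ≥0} {Φ : Ω → PointConfig}

theorem lintegral_count (hΦ : IsPoissonPointProcess P r Φ) {B : Set E3} (hB : MeasurableSet B)
    (hb : Bornology.IsBounded B) : ∫⁻ ω, ((Φ ω).count B : ℝ≥0∞) ∂P = r * volume B := by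
  rw [(hΦ.count_law B hB hb).lintegral_comp (f := fun n : ℕ∞ => (n : ℝ≥0∞))
    Measurable.of_discrete.aemeasurable, lintegral_map .of_discrete .of_discrete]
  simp only [ENat.toENNReal_coe]
  rw [lintegral_natCast_poissonMeasure, ENNReal.coe_mul, ENNReal.coe_toNNReal hb.measure_lt_top.ne]

theorem measure_count_eq_zero (hΦ : IsPoissonPointProcess P r Φ) {C : Set E3}
    (hC : MeasurableSet C) (hb : Bornology.IsBounded C) :
    P {ω | (Φ ω).count C = 0} = ENNReal.ofReal (Real.exp (-(r * (volume C).toReal))) := by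
  rw [(hΦ.count_law C hC hb).measure_eq (p := fun n : ℕ∞ => n = 0) (measurableSet_singleton 0),
    Measure.map_apply .of_discrete (MeasurableSet.of_discrete)]
  have : (fun n : ℕ => (n : ℕ∞)) ⁻¹' {x | x = 0} = {0} := by ext n; simp
  rw [this, poissonMeasure_singleton]
  simp [ENNReal.toReal]

theorem lintegral_count_void (hΦ : IsPoissonPointProcess P r Φ) {B C : Set E3}
    (hB : MeasurableSet B) (hBb : Bornology.IsBounded B) (hC : MeasurableSet C)
    (hCb : Bornology.IsBounded C) (hd : Disjoint B C) :
    ∫⁻ ω in {ω | (Φ ω).count C = 0}, ((Φ ω).count B : ℝ≥0∞) ∂P =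
      r * volume B * P {ω | (Φ ω).count C = 0} := by
  have hmC : MeasurableSet {ω | (Φ ω).count C = 0} :=
    (measurable_count hC).comp hΦ.measurable (measurableSet_singleton 0)
  have hind : IndepFun (fun ω => (Φ ω).count B) (fun ω => (Φ ω).count C) P := by
    refine (hΦ.indep 2 ![B, C] ?_ ?_ ?_).indepFun (i := 0) (j := 1) (by simp)
    · simp [Fin.forall_fin_two, hB, hC]
    · simp [Fin.forall_fin_two, hBb, hCb]
    · intro i j hij
      fin_cases i <;> fin_cases j <;> simp_all [disjoint_comm]
  have h := lintegral_mul_eq_lintegral_mul_lintegral_of_indepFun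
    (μ := P) (f := fun ω => ((Φ ω).count B : ℝ≥0∞))
    (g := fun ω => ({0} : Set ℕ∞).indicator (1 : ℕ∞ → ℝ≥0∞) ((Φ ω).count C))
    ((Measurable.of_discrete (f := fun n : ℕ∞ => (n : ℝ≥0∞))).comp
      ((measurable_count hB).comp hΦ.measurable))
    ((Measurable.of_discrete (f := ({0} : Set ℕ∞).indicator (1 : ℕ∞ → ℝ≥0∞))).comp
      ((measurable_count hC).comp hΦ.measurable))
    (hind.comp (φ := fun n : ℕ∞ => (n : ℝ≥0∞)) (ψ := ({0} : Set ℕ∞).indicator (1 : ℕ∞ → ℝ≥0∞))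
      .of_discrete .of_discrete)
  have e1 : (fun ω => ({0} : Set ℕ∞).indicator (1 : ℕ∞ → ℝ≥0∞) ((Φ ω).count C)) =
      {ω | (Φ ω).count C = 0}.indicator 1 := rfl
  rw [e1, lintegral_indicator_one hmC, hΦ.lintegral_count hB hBb] at h
  rw [← h, ← lintegral_indicator hmC]
  refine lintegral_congr fun ω => ?_
  by_cases hω : ω ∈ {ω | (Φ ω).count C = 0}
  · rw [Set.indicator_of_mem hω]; simp [Set.indicator_of_mem hω]
  · rw [Set.indicator_of_notMem hω]; simp [Set.indicator_of_notMem hω]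

/-- Mecke's formula as an identity of measures, checked on products of a void event and a bounded
set. Only the mean of a count, and the independence of the counts in the disjoint sets `B \ C` and
`C`, are needed. -/
theorem compProd_pointKernel [IsProbabilityMeasure P] (hΦ : IsPoissonPointProcess P r Φ) :
    (P.map Φ) ⊗ₘ pointKernel =
      ((P.map Φ).prod ((r : ℝ≥0∞) • (volume : Measure E3))).map
        fun p => (p.1.insertPoint p.2, p.2) := by
  have := Measure.isProbabilityMeasure_map (μ := P) hΦ.measurable.aemeasurable
  have hmap : Measurable fun p : PointConfig × E3 => (p.1.insertPoint p.2, p.2) :=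
    (measurable_insertPoint.comp measurable_swap).prodMk measurable_snd
  let D : Set (Set E3) := {B | MeasurableSet B ∧ Bornology.IsBounded B}
  have hD : MeasurableSpace.generateFrom D = (inferInstance : MeasurableSpace E3) := by
    refine le_antisymm (MeasurableSpace.generateFrom_le fun B hB => hB.1) fun B hB => ?_
    have : B = ⋃ n : ℕ, B ∩ Metric.ball 0 n := by
      rw [← Set.inter_iUnion, Metric.iUnion_ball_nat, Set.inter_univ]
    rw [this]
    exact MeasurableSet.iUnion fun n => MeasurableSpace.measurableSet_generateFrom
      ⟨hB.inter measurableSet_ball, Metric.isBounded_ball.subset Set.inter_subset_right⟩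
  have hDpi : IsPiSystem D := fun B hB C hC _ =>
    ⟨hB.1.inter hC.1, hB.2.subset Set.inter_subset_left⟩
  have hDs : IsCountablySpanning D :=
    ⟨fun n => Metric.ball 0 n, fun n => ⟨measurableSet_ball, Metric.isBounded_ball⟩,
      Metric.iUnion_ball_nat 0⟩
  have huniv : Set.univ ∈ voidEvents :=
    ⟨∅, MeasurableSet.empty, Bornology.isBounded_empty, by ext φ; simp [count_eq_zero]⟩
  have hVs : IsCountablySpanning voidEvents :=
    ⟨fun _ => Set.univ, fun _ => huniv, Set.iUnion_const _⟩
  have key : ∀ s ∈ Set.image2 (· ×ˢ ·) voidEvents D,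
      ((P.map Φ) ⊗ₘ pointKernel) s =
      (((P.map Φ).prod ((r : ℝ≥0∞) • (volume : Measure E3))).map
        fun p => (p.1.insertPoint p.2, p.2)) s ∧ ((P.map Φ) ⊗ₘ pointKernel) s < ∞ := by
    rintro _ ⟨_, ⟨C, hC, hCb, rfl⟩, B, ⟨hB, hBb⟩, rfl⟩
    have hV : MeasurableSet {φ : PointConfig | φ.count C = 0} :=
      measurable_count hC (measurableSet_singleton 0)
    -- If `C` contains no point after `x` is added, then `x` itself avoids `C`; this replaces `B` by
    -- `B \ C`.
    have hpre : (fun p : PointConfig × E3 => (p.1.insertPoint p.2, p.2)) ⁻¹'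
        ({φ : PointConfig | φ.count C = 0} ×ˢ B) = {φ : PointConfig | φ.count C = 0} ×ˢ (B \ C) := by
      ext ⟨φ, x⟩
      simp only [Set.mem_preimage, Set.mem_prod, Set.mem_ofPred_eq, count_eq_zero,
        mem_points_insertPoint, Set.mem_sdiff]
      constructor
      · rintro ⟨h, hx⟩
        exact ⟨fun y hy => h y (Or.inr hy), hx, h x (Or.inl rfl)⟩
      · rintro ⟨h, hx, hxC⟩
        exact ⟨by rintro y (rfl | hy); exacts [hxC, h y hy], hx⟩
    have h1 : ((P.map Φ) ⊗ₘ pointKernel) ({φ : PointConfig | φ.count C = 0} ×ˢ B) =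
        r * volume (B \ C) * P {ω | (Φ ω).count C = 0} := by
      rw [Measure.compProd_apply_prod hV hB, ← hΦ.lintegral_count_void (hB.diff hC)
        (hBb.subset Set.sdiff_subset) hC hCb Set.disjoint_sdiff_left,
        setLIntegral_map hV (pointKernel.measurable_coe hB) hΦ.measurable]
      refine setLIntegral_congr_fun (hΦ.measurable hV) fun ω hω => ?_
      simp only [pointKernel_apply]
      rw [pointMeasure_apply _ hB, count, count]
      congr 2
      ext x
      exact ⟨fun h => ⟨h.1, h.2, count_eq_zero.1 hω x h.1⟩, fun h => ⟨h.1, h.2.1⟩⟩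
    constructor
    · rw [Measure.map_apply hmap (hV.prod hB), hpre, Measure.prod_prod,
        Measure.map_apply hΦ.measurable hV, h1, Measure.smul_apply, smul_eq_mul, mul_comm]
      rfl
    · dsimp only
      rw [h1]
      exact ENNReal.mul_lt_top (ENNReal.mul_lt_top ENNReal.coe_lt_top
        (hBb.subset Set.sdiff_subset).measure_lt_top) (measure_lt_top _ _)
  refine Measure.ext_of_generateFrom_of_iUnion (Set.image2 (· ×ˢ ·) voidEvents D)
    (fun n : ℕ => Set.univ ×ˢ Metric.ball (0 : E3) n)
    (generateFrom_eq_prod generateFrom_voidEvents hD hVs hDs).symm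
    (isPiSystem_voidEvents.prod hDpi) ?_ ?_ ?_ fun s hs => (key s hs).1
  · rw [← Set.prod_iUnion, Metric.iUnion_ball_nat, Set.univ_prod_univ]
  · exact fun n => ⟨_, huniv, _, ⟨measurableSet_ball, Metric.isBounded_ball⟩, rfl⟩
  · exact fun n => (key _ ⟨_, huniv, _, ⟨measurableSet_ball, Metric.isBounded_ball⟩, rfl⟩).2.ne

/-- Mecke's formula. -/
theorem lintegral_lintegral_pointMeasure [IsProbabilityMeasure P]
    (hΦ : IsPoissonPointProcess P r Φ) {F : PointConfig → E3 → ℝ≥0∞}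
    (hF : Measurable (Function.uncurry F)) :
    ∫⁻ ω, ∫⁻ x, F (Φ ω) x ∂(Φ ω).pointMeasure ∂P =
      r * ∫⁻ x, ∫⁻ ω, F ((Φ ω).insertPoint x) x ∂P := by
  have := Measure.isProbabilityMeasure_map (μ := P) hΦ.measurable.aemeasurable
  have hmap : Measurable fun p : PointConfig × E3 => (p.1.insertPoint p.2, p.2) :=
    (measurable_insertPoint.comp measurable_swap).prodMk measurable_snd
  have h := congrArg (fun M => ∫⁻ p, Function.uncurry F p ∂M) hΦ.compProd_pointKernel
  rw [Measure.lintegral_compProd hF, lintegral_map hF hmap,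
    lintegral_prod_symm (fun p : PointConfig × E3 => Function.uncurry F (p.1.insertPoint p.2, p.2))
      (hF.comp hmap).aemeasurable, lintegral_smul_measure,
    lintegral_map hF.lintegral_kernel_prod_right' hΦ.measurable] at h
  refine h.trans ?_
  rw [smul_eq_mul]
  congr 1
  refine lintegral_congr fun x => ?_
  rw [lintegral_map _ hΦ.measurable]
  · rfl
  · exact (hF.comp hmap).comp measurable_prodMk_right

end IsPoissonPointProcess

/-! ### Thales' theorem and a radial integral -/

theorem dist_midpoint_sq (X Y Z : E3) :
    dist (midpoint ℝ X Y) Z ^ 2 = (dist X Y / 2) ^ 2 + inner ℝ (X - Z) (Y - Z) := by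
  have h1 : midpoint ℝ X Y - Z = (2⁻¹ : ℝ) • ((X - Z) + (Y - Z)) := by
    rw [midpoint_eq_smul_add, invOf_eq_inv]
    module
  have h2 : X - Y = (X - Z) - (Y - Z) := by abel
  rw [dist_eq_norm, dist_eq_norm, h1, h2]
  generalize X - Z = a, Y - Z = b
  rw [norm_smul, mul_pow, div_pow, norm_add_sq_real, norm_sub_sq_real, Real.norm_of_nonneg (by norm_num)]
  ring

theorem dist_midpoint_eq_iff {X Y Z : E3} :
    dist (midpoint ℝ X Y) Z = dist X Y / 2 ↔ inner ℝ (X - Z) (Y - Z) = 0 := by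
  rw [← sq_eq_sq₀ dist_nonneg (by positivity), dist_midpoint_sq]
  simp

theorem dist_midpoint_left_half (X Y : E3) : dist (midpoint ℝ X Y) X = dist X Y / 2 :=
  dist_midpoint_eq_iff.2 (by simp)

theorem dist_midpoint_right_half (X Y : E3) : dist (midpoint ℝ X Y) Y = dist X Y / 2 :=
  dist_midpoint_eq_iff.2 (by simp)

/-- Scaling by the cube root of `c` reduces to `c = 1`. There the integral is the volume of the unit
ball times `Γ(3/3 + 1) = 1`. -/
theorem lintegral_exp_neg_mul_norm_cube {c : ℝ} (hc : 0 < c) :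
    ∫⁻ x : E3, ENNReal.ofReal (Real.exp (-(c * ‖x‖ ^ 3))) =
      ENNReal.ofReal (c⁻¹ * (Real.pi * 4 / 3)) := by
  have h0 : ∫ x : E3, Real.exp (-‖x‖ ^ (3 : ℝ)) = Real.pi * 4 / 3 := by
    have h := measure_lt_one_eq_integral_div_gamma (volume : Measure E3) (g := fun x => ‖x‖)
      norm_zero norm_neg norm_add_le (fun h => norm_eq_zero.1 h)
      (fun r x => (norm_smul r x).le) (p := 3) (by norm_num)
    have hb : {x : E3 | ‖x‖ < 1} = Metric.ball 0 1 := by ext; simp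
    rw [hb, EuclideanSpace.volume_ball_fin_three, finrank_euclideanSpace_fin] at h
    norm_num at h
    rw [ENNReal.ofReal_eq_ofReal_iff (by positivity)
      (integral_nonneg fun x => (Real.exp_pos _).le)] at h
    norm_num
    exact h.symm
  have hc3 : (c ^ (3⁻¹ : ℝ)) ^ 3 = c := by
    rw [← Real.rpow_natCast, ← Real.rpow_mul hc.le]; norm_num
  have h1 : ∫ x : E3, Real.exp (-(c * ‖x‖ ^ 3)) = c⁻¹ * (Real.pi * 4 / 3) := by
    have h := Measure.integral_comp_smul (volume : Measure E3)
      (fun x : E3 => Real.exp (-‖x‖ ^ (3 : ℝ))) (c ^ (3⁻¹ : ℝ))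
    rw [h0, finrank_euclideanSpace_fin, hc3, abs_of_pos (inv_pos.2 hc), smul_eq_mul] at h
    rw [← h]
    congr 1
    ext x
    rw [norm_smul, Real.norm_of_nonneg (by positivity), show (3 : ℝ) = (3 : ℕ) by norm_num,
      Real.rpow_natCast, mul_pow]
    push_cast
    rw [hc3]
  rw [← ofReal_integral_eq_lintegral_ofReal _ (ae_of_all _ fun x => (Real.exp_pos _).le), h1]
  -- A non-integrable function would have Bochner integral `0` by default, whereas the value found
  -- is positive.
  refine not_imp_comm.1 integral_undef ?_
  rw [h1]
  positivity

/-! ### Facet midpoints and Gabriel neighbours -/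

namespace PointConfig

/-- No point of the configuration sees two others under a right angle. -/
def NoRightAngle (φ : PointConfig) : Prop :=
  ∀ Z ∈ φ.points, ∀ X ∈ φ.points, ∀ Y ∈ φ.points, X ≠ Z → Y ≠ Z →
    inner ℝ (X - Z) (Y - Z) ≠ (0 : ℝ)

theorem NoRightAngle.shift {φ : PointConfig} (h : φ.NoRightAngle) (x : E3) :
    (φ.shift x).NoRightAngle := by
  intro Z hZ X hX Y hY hXZ hYZ
  have := h _ hZ _ hX _ hY (fun h => hXZ (add_right_cancel h)) fun h => hYZ (add_right_cancel h)
  simpa using this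

/-- The open ball with diameter `XY`. -/
def diameterBall (X Y : E3) : Set E3 := Metric.ball (midpoint ℝ X Y) (dist X Y / 2)

theorem left_notMem_diameterBall (X Y : E3) : X ∉ diameterBall X Y := by
  rw [diameterBall, Metric.mem_ball, dist_comm, dist_midpoint_left_half]
  exact lt_irrefl _

theorem right_notMem_diameterBall (X Y : E3) : Y ∉ diameterBall X Y := by
  rw [diameterBall, Metric.mem_ball, dist_comm, dist_midpoint_right_half]
  exact lt_irrefl _

/-- The points of `φ` other than `X` whose diametral ball with `X` is empty: the neighbours of
`X` in the Gabriel graph of `φ`. -/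
def gabrielNeighbors (φ : PointConfig) (X : E3) : Set E3 :=
  {Y | Y ≠ X ∧ φ.count (diameterBall X Y) = 0}

theorem midpoint_mem_voronoiFacet {φ : PointConfig} {X Y : E3}
    (h : φ.count (diameterBall X Y) = 0) : midpoint ℝ X Y ∈ φ.voronoiFacet X Y := by
  have h : ∀ Z ∈ φ.points, dist X Y / 2 ≤ dist (midpoint ℝ X Y) Z := fun Z hZ => by
    rw [dist_comm _ Z]
    exact not_lt.1 (count_eq_zero.1 h Z hZ)
  refine ⟨fun Z hZ => ?_, fun Z hZ => ?_⟩
  · rw [dist_midpoint_left_half]; exact h Z hZ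
  · rw [dist_midpoint_right_half]; exact h Z hZ

/-- The facet lies in the perpendicular bisector of the two nuclei. -/
theorem vectorSpan_voronoiFacet_le {φ : PointConfig} {X Y : E3} (hX : X ∈ φ.points)
    (hY : Y ∈ φ.points) : vectorSpan ℝ (φ.voronoiFacet X Y) ≤ (Submodule.span ℝ {Y - X})ᗮ := by
  have h : ∀ p ∈ φ.voronoiFacet X Y, 2 * inner ℝ (Y - X) p = ‖Y‖ ^ 2 - ‖X‖ ^ 2 := by
    intro p hp
    have h1 : dist p X ^ 2 = dist p Y ^ 2 := by
      rw [le_antisymm (hp.1 Y hY) (hp.2 X hX)]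
    rw [dist_eq_norm, dist_eq_norm, norm_sub_sq_real, norm_sub_sq_real] at h1
    rw [inner_sub_left, real_inner_comm, real_inner_comm p X]
    linarith
  refine Submodule.span_le.2 ?_
  rintro _ ⟨p, hp, q, hq, rfl⟩
  simp only [SetLike.mem_coe, Submodule.mem_orthogonal_singleton_iff_inner_right, vsub_eq_sub,
    inner_sub_right]
  linarith [h p hp, h q hq]

-- At the midpoint, every third point is strictly farther away than `X` and `Y`. This persists under
-- a small displacement in the bisector, because local finiteness leaves only finitely many points
-- to control.
open Filter Topology in
theorem eventually_mem_voronoiFacet {φ : PointConfig} (hφ : φ.NoRightAngle) {X Y : E3}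
    (hX : X ∈ φ.points) (hY : Y ∈ φ.points) (h : φ.count (diameterBall X Y) = 0) :
    ∀ᶠ v : E3 in 𝓝 0, inner ℝ (Y - X) v = (0 : ℝ) →
      midpoint ℝ X Y + v ∈ φ.voronoiFacet X Y := by
  set m := midpoint ℝ X Y with hm
  -- For `‖v‖ < 1`, the margin `2` pays for the displacement twice: once in the distance to `X`,
  -- once in the distance to `Z`.
  have hfar : ∀ᶠ v : E3 in 𝓝 0, ∀ Z ∈ φ.points, Z ∉ Metric.ball m (dist X Y / 2 + 2) →
      dist (m + v) X ≤ dist (m + v) Z := by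
    filter_upwards [Metric.ball_mem_nhds (0 : E3) one_pos] with v hv Z _ hZ
    rw [mem_ball_zero_iff] at hv
    rw [Metric.mem_ball, not_lt, dist_comm Z] at hZ
    have h1 : dist (m + v) m = ‖v‖ := by simp [dist_eq_norm]
    have h2 := dist_triangle (m + v) m X
    have h3 := dist_triangle_left m Z (m + v)
    have h4 : dist m X = dist X Y / 2 := dist_midpoint_left_half X Y
    linarith
  have hnear : ∀ᶠ v : E3 in 𝓝 0, ∀ Z ∈ φ.points ∩ Metric.ball m (dist X Y / 2 + 2),
      Z ≠ X → Z ≠ Y → dist (m + v) X ≤ dist (m + v) Z := by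
    rw [eventually_all_finite (φ.finite_inter Metric.isBounded_ball)]
    rintro Z ⟨hZ, -⟩
    by_cases hZX : Z = X
    · exact Eventually.of_forall fun v h => absurd hZX h
    by_cases hZY : Z = Y
    · exact Eventually.of_forall fun v _ h => absurd hZY h
    -- Equality would put `Z` on the sphere with diameter `XY`, hence a right angle at `Z`.
    have hlt : dist (m + 0) X < dist (m + 0) Z := by
      rw [add_zero]
      refine lt_of_le_of_ne ((midpoint_mem_voronoiFacet h).1 Z hZ) fun heq => ?_
      rw [hm, dist_midpoint_left_half] at heq
      exact hφ Z hZ X hX Y hY (Ne.symm hZX) (Ne.symm hZY) (dist_midpoint_eq_iff.1 heq.symm)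
    have hc : ∀ W : E3, ContinuousAt (fun v : E3 => dist (m + v) W) 0 := fun W => by fun_prop
    filter_upwards [(hc X).eventually_lt (hc Z) hlt] with v hv _ _ using hv.le
  filter_upwards [hfar, hnear] with v hf hn hv
  have heq : dist (m + v) X = dist (m + v) Y := by
    rw [← sq_eq_sq₀ dist_nonneg dist_nonneg]
    have e1 : m + v - X = (2⁻¹ : ℝ) • (Y - X) + v := by
      rw [hm, midpoint_eq_smul_add, invOf_eq_inv]; module
    have e2 : m + v - Y = v - (2⁻¹ : ℝ) • (Y - X) := by
      rw [hm, midpoint_eq_smul_add, invOf_eq_inv]; module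
    rw [dist_eq_norm, dist_eq_norm, e1, e2, norm_add_sq_real, norm_sub_sq_real, inner_smul_left,
      inner_smul_right, hv, real_inner_comm, hv]
    simp
    ring
  have hall : ∀ Z ∈ φ.points, dist (m + v) X ≤ dist (m + v) Z := by
    intro Z hZ
    by_cases hZX : Z = X
    · rw [hZX]
    by_cases hZY : Z = Y
    · rw [hZY, heq]
    by_cases hb : Z ∈ Metric.ball m (dist X Y / 2 + 2)
    · exact hn Z ⟨hZ, hb⟩ hZX hZY
    · exact hf Z hZ hb
  exact ⟨hall, fun Z hZ => heq ▸ hall Z hZ⟩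

open Filter Topology in
theorem isDelaunayPair_of_mem_gabrielNeighbors {φ : PointConfig} (hφ : φ.NoRightAngle) {X Y : E3}
    (hX : X ∈ φ.points) (hY : Y ∈ φ.points) (h : Y ∈ φ.gabrielNeighbors X) :
    φ.IsDelaunayPair X Y := by
  refine ⟨hX, hY, h.1.symm, ?_⟩
  have hspan : vectorSpan ℝ (φ.voronoiFacet X Y) = (Submodule.span ℝ {Y - X})ᗮ := by
    refine le_antisymm (vectorSpan_voronoiFacet_le hX hY) fun v hv => ?_
    rw [Submodule.mem_orthogonal_singleton_iff_inner_right] at hv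
    -- A nonzero small multiple of `v` stays in the facet, which puts `v` itself in the direction
    -- space.
    have ht : Tendsto (fun t : ℝ => t • v) (𝓝[≠] 0) (𝓝 0) := by
      have : ContinuousAt (fun t : ℝ => t • v) 0 := by fun_prop
      simpa [ContinuousAt] using this.mono_left nhdsWithin_le_nhds
    obtain ⟨t, htm, ht0⟩ := ((ht.eventually (eventually_mem_voronoiFacet hφ hX hY h.2)).and
      self_mem_nhdsWithin).exists
    have ht0 : t ≠ 0 := ht0
    have h1 := vsub_mem_vectorSpan ℝ (htm (by rw [inner_smul_right, hv, mul_zero]))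
      (midpoint_mem_voronoiFacet h.2)
    rw [vsub_eq_sub, add_sub_cancel_left] at h1
    simpa [smul_smul, ht0] using Submodule.smul_mem _ t⁻¹ h1
  rw [hspan]
  have : Fact (Module.finrank ℝ E3 = 2 + 1) := ⟨by simp⟩
  exact Submodule.finrank_orthogonal_span_singleton (sub_ne_zero.2 h.1)

/-- A midpoint in the cell of `W` is at distance `dist X Y / 2` from `W`. By Thales, `W` is then `X`
or `Y`, or else the apex of a right angle. -/
theorem facetMidpoints_inter_voronoiCell {φ : PointConfig} (hφ : φ.NoRightAngle) {W : E3}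
    (hW : W ∈ φ.points) : φ.facetMidpoints ∩ φ.voronoiCell W =
      (fun Y => midpoint ℝ W Y) '' (φ.points ∩ φ.gabrielNeighbors W) := by
  have hempty : ∀ Y, midpoint ℝ W Y ∈ φ.voronoiCell W → φ.count (diameterBall W Y) = 0 := by
    refine fun Y h => count_eq_zero.2 fun Z hZ => ?_
    rw [diameterBall, Metric.mem_ball, dist_comm, not_lt, ← dist_midpoint_left_half]
    exact h Z hZ
  apply subset_antisymm
  · rintro _ ⟨⟨X, Y, hD, rfl, hz⟩, hzW⟩
    have heq : dist (midpoint ℝ X Y) W = dist X Y / 2 := by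
      rw [← dist_midpoint_left_half]
      exact le_antisymm (hzW X hD.1) (hz.1 W hW)
    by_cases hXW : X = W
    · subst hXW
      exact ⟨Y, ⟨hD.2.1, hD.2.2.1.symm, hempty Y hzW⟩, rfl⟩
    by_cases hYW : Y = W
    · subst hYW
      rw [midpoint_comm] at hzW ⊢
      exact ⟨X, ⟨hD.1, hD.2.2.1, hempty X hzW⟩, rfl⟩
    · exact absurd (dist_midpoint_eq_iff.1 heq) (hφ W hW X hD.1 Y hD.2.1 hXW hYW)
  · rintro _ ⟨Y, ⟨hY, hG⟩, rfl⟩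
    have hz := midpoint_mem_voronoiFacet hG.2
    exact ⟨⟨W, Y, isDelaunayPair_of_mem_gabrielNeighbors hφ hW hY hG, rfl, hz⟩, hz.1⟩

theorem midpointsInZeroCell_eq {φ : PointConfig} (hφ : φ.NoRightAngle) (h0 : 0 ∈ φ.points) :
    φ.midpointsInZeroCell = φ.count (φ.gabrielNeighbors 0) := by
  rw [midpointsInZeroCell, facetMidpoints_inter_voronoiCell hφ h0, count]
  exact Function.Injective.encard_image (fun Y Z h => by simpa [midpoint_eq_smul_add] using h) _

end PointConfig

/-! ### Measurability of Gabriel counts; right angles are exceptional -/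

namespace PointConfig

theorem measurableSet_gabrielNeighbors :
    MeasurableSet {p : (E3 × PointConfig) × E3 | p.2 ∈ p.1.2.gabrielNeighbors p.1.1} := by
  have hX : Measurable fun p : (E3 × PointConfig) × E3 => p.1.1 := by fun_prop
  have h1 : MeasurableSet {p : (E3 × PointConfig) × E3 | p.2 ≠ p.1.1} :=
    (measurableSet_eq_fun measurable_snd hX).compl
  have h2 : Measurable fun p : (E3 × PointConfig) × E3 => p.1.2.count (diameterBall p.1.1 p.2) := by
    refine measurable_count_of (by fun_prop) ?_
    simp only [diameterBall, Metric.mem_ball, midpoint_eq_smul_add]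
    refine measurableSet_lt (by fun_prop) (by fun_prop)
  exact h1.inter (h2 (measurableSet_singleton 0))

theorem measurable_count_gabrielNeighbors :
    Measurable fun p : E3 × PointConfig => (p.2.count (p.2.gabrielNeighbors p.1) : ℝ≥0∞) :=
  (Measurable.of_discrete (f := fun n : ℕ∞ => (n : ℝ≥0∞))).comp
    (measurable_count_of measurable_snd measurableSet_gabrielNeighbors)

theorem diameterBall_sub (X Y y : E3) : y - X ∈ diameterBall 0 (Y - X) ↔ y ∈ diameterBall X Y := by
  have h : y - X - midpoint ℝ 0 (Y - X) = y - midpoint ℝ X Y := by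
    rw [midpoint_eq_smul_add, midpoint_eq_smul_add, invOf_eq_inv]
    module
  rw [diameterBall, diameterBall, Metric.mem_ball, Metric.mem_ball, dist_eq_norm, h, dist_zero_left,
    dist_eq_norm, dist_comm, dist_eq_norm]

theorem count_gabrielNeighbors_shift (X : E3) (φ : PointConfig) :
    (φ.shift X).count ((φ.shift X).gabrielNeighbors 0) = φ.count (φ.gabrielNeighbors X) := by
  rw [count_shift]
  congr 1
  ext Y
  simp only [gabrielNeighbors, Set.mem_ofPred_eq, count_shift, diameterBall_sub, sub_ne_zero]
  rfl

theorem count_insertPoint_of_notMem {x : E3} {φ : PointConfig} {B : Set E3} (h : x ∉ B) :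
    (φ.insertPoint x).count B = φ.count B := by
  rw [count, count]
  congr 1
  ext y
  constructor
  · rintro ⟨rfl | hy, hB⟩
    exacts [absurd hB h, ⟨hy, hB⟩]
  · exact fun hy => ⟨Or.inr hy.1, hy.2⟩

/-- `X` is not its own neighbour and lies on the boundary of each of its open diametral balls, so
adding it has no effect. -/
theorem count_gabrielNeighbors_insertPoint (X : E3) (φ : PointConfig) :
    (φ.insertPoint X).count ((φ.insertPoint X).gabrielNeighbors X) =
      φ.count (φ.gabrielNeighbors X) := by
  rw [count_insertPoint_of_notMem fun h => h.1 rfl]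
  congr 1
  ext Y
  simp only [gabrielNeighbors, Set.mem_ofPred_eq,
    count_insertPoint_of_notMem (left_notMem_diameterBall X Y)]

/-- Triples `(Z, X, Y)` with a right angle at `Z`. -/
def rightAngles : Set (E3 × E3 × E3) :=
  {p | p.2.1 ≠ p.1 ∧ p.2.2 ≠ p.1 ∧ inner ℝ (p.2.1 - p.1) (p.2.2 - p.1) = (0 : ℝ)}

theorem measurableSet_rightAngles : MeasurableSet rightAngles := by
  refine MeasurableSet.inter ?_ (MeasurableSet.inter ?_ ?_)
  · exact (measurableSet_eq_fun (by fun_prop) (by fun_prop)).compl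
  · exact (measurableSet_eq_fun (by fun_prop) (by fun_prop)).compl
  · exact measurableSet_eq_fun (by fun_prop) (by fun_prop)

/-- The number of pairs of points of `φ` which `Z` sees under a right angle. -/
noncomputable def rightAngleCount (φ : PointConfig) (Z : E3) : ℝ≥0∞ :=
  ∫⁻ X, ∫⁻ Y, rightAngles.indicator 1 (Z, X, Y) ∂φ.pointMeasure ∂φ.pointMeasure

theorem measurable_rightAngleCount : Measurable (Function.uncurry rightAngleCount) := by
  refine measurable_lintegral_pointMeasure (c := fun p : PointConfig × E3 => p.1) measurable_fst ?_
  refine measurable_lintegral_pointMeasure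
    (c := fun p : (PointConfig × E3) × E3 => p.1.1) (by fun_prop)
    (f := fun p Y => rightAngles.indicator 1 (p.1.2, p.2, Y)) ?_
  have : Measurable fun q : ((PointConfig × E3) × E3) × E3 => (q.1.1.2, q.1.2, q.2) := by fun_prop
  exact (measurable_one.indicator measurableSet_rightAngles).comp this

theorem rightAngleCount_eq_zero {φ : PointConfig} {Z : E3} : φ.rightAngleCount Z = 0 ↔
    ∀ X ∈ φ.points, ∀ Y ∈ φ.points, X ≠ Z → Y ≠ Z → inner ℝ (X - Z) (Y - Z) ≠ (0 : ℝ) := by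
  simp only [rightAngleCount, lintegral_pointMeasure_eq_zero, Set.indicator_apply_eq_zero,
    Pi.one_apply, one_ne_zero, imp_false, rightAngles, Set.mem_ofPred_eq, not_and]

theorem lintegral_rightAngleCount_eq_zero {φ : PointConfig} :
    ∫⁻ Z, φ.rightAngleCount Z ∂φ.pointMeasure = 0 ↔ φ.NoRightAngle := by
  simp only [lintegral_pointMeasure_eq_zero, rightAngleCount_eq_zero]
  rfl

theorem measurableSet_noRightAngle : MeasurableSet {φ : PointConfig | φ.NoRightAngle} := by
  simp_rw [← lintegral_rightAngleCount_eq_zero]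
  exact (measurable_lintegral_pointMeasure measurable_id measurable_rightAngleCount)
    (measurableSet_singleton 0)

/-- By Thales, the bad positions of `Z` lie on countably many spheres, one for each pair of points
of `φ`, and spheres are null. -/
theorem ae_rightAngleCount_insertPoint (φ : PointConfig) :
    ∀ᵐ Z : E3, (φ.insertPoint Z).rightAngleCount Z = 0 := by
  have h : ∀ᵐ Z : E3, ∀ X ∈ φ.points, ∀ Y ∈ φ.points,
      Z ∉ Metric.sphere (midpoint ℝ X Y) (dist X Y / 2) := by
    refine (ae_ball_iff φ.countable_points).2 fun X _ =>
      (ae_ball_iff φ.countable_points).2 fun Y _ => ?_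
    exact measure_eq_zero_iff_ae_notMem.1 (Measure.addHaar_sphere _ _ _)
  filter_upwards [h] with Z hZ
  refine rightAngleCount_eq_zero.2 fun X hX Y hY hXZ hYZ h0 => ?_
  refine hZ X (hX.resolve_left hXZ) Y (hY.resolve_left hYZ) ?_
  rw [Metric.mem_sphere, dist_comm]
  exact dist_midpoint_eq_iff.2 h0

end PointConfig

/-! ### Palm measure and the expected count -/

open PointConfig

theorem isBounded_unitCube : Bornology.IsBounded unitCube := by
  refine (Metric.isBounded_closedBall (x := (0 : E3)) (r := √3)).subset fun x hx => ?_
  rw [mem_closedBall_zero_iff, EuclideanSpace.norm_eq]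
  refine Real.sqrt_le_sqrt ?_
  have h : ∀ i, ‖x i‖ ^ 2 ≤ 1 := fun i => by
    rw [Real.norm_of_nonneg (hx i).1]
    exact pow_le_one₀ (hx i).1 (hx i).2.le
  calc ∑ i, ‖x i‖ ^ 2 ≤ ∑ _i : Fin 3, (1 : ℝ) := Finset.sum_le_sum fun i _ => h i
    _ = 3 := by simp

theorem unitCube_eq_preimage :
    unitCube = WithLp.ofLp ⁻¹' (Set.univ.pi fun _ : Fin 3 => Set.Ico (0 : ℝ) 1) := by
  ext x
  simp [unitCube]

theorem measurableSet_unitCube : MeasurableSet unitCube := by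
  rw [unitCube_eq_preimage]
  exact (WithLp.measurable_ofLp ..) (MeasurableSet.univ_pi fun _ => measurableSet_Ico)

theorem volume_unitCube : volume unitCube = 1 := by
  rw [unitCube_eq_preimage, (PiLp.volume_preserving_ofLp (Fin 3)).measure_preimage
    (MeasurableSet.univ_pi fun _ => measurableSet_Ico).nullMeasurableSet, volume_pi_pi]
  simp

namespace IsPoissonPointProcess

variable {Ω : Type*} [MeasurableSpace Ω] {P : Measure Ω} {r : ℝ≥0} {Φ : Ω → PointConfig}

theorem ppIntensity_eq (hΦ : IsPoissonPointProcess P r Φ) : ppIntensity P Φ = r := by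
  rw [ppIntensity, hΦ.lintegral_count measurableSet_unitCube isBounded_unitCube, volume_unitCube,
    mul_one]

/-- Mecke's formula is applied to the apex alone: with the other points fixed, almost every position
of the apex is good. -/
theorem ae_noRightAngle [IsProbabilityMeasure P] (hΦ : IsPoissonPointProcess P r Φ) :
    ∀ᵐ ω ∂P, (Φ ω).NoRightAngle := by
  have hm : Measurable fun p : E3 × Ω => ((Φ p.2).insertPoint p.1).rightAngleCount p.1 :=
    measurable_rightAngleCount.comp
      ((measurable_insertPoint.comp (measurable_fst.prodMk (hΦ.measurable.comp measurable_snd))).prodMk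
        measurable_fst)
  have h := hΦ.lintegral_lintegral_pointMeasure measurable_rightAngleCount
  rw [lintegral_lintegral_swap hm.aemeasurable] at h
  simp_rw [lintegral_congr_ae (ae_rightAngleCount_insertPoint _), lintegral_zero, mul_zero] at h
  have hm' : Measurable fun ω => ∫⁻ Z, (Φ ω).rightAngleCount Z ∂(Φ ω).pointMeasure :=
    (measurable_lintegral_pointMeasure measurable_id measurable_rightAngleCount).comp hΦ.measurable
  rw [lintegral_eq_zero_iff hm'] at h
  filter_upwards [h] with ω hω
  exact lintegral_rightAngleCount_eq_zero.1 hω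

theorem lintegral_palmMeasure (hΦ : IsPoissonPointProcess P r Φ) {f : PointConfig → ℝ≥0∞}
    (hf : Measurable f) : ∫⁻ φ, f φ ∂palmMeasure P Φ =
      (r : ℝ≥0∞)⁻¹ * ∫⁻ ω, ∫⁻ X in unitCube, f ((Φ ω).shift X) ∂(Φ ω).pointMeasure ∂P := by
  have hsum : ∀ (g : PointConfig → ℝ≥0∞), Measurable g → ∀ ω,
      ∫⁻ φ, g φ ∂(Measure.sum fun X : ↥((Φ ω).points ∩ unitCube) =>
        Measure.dirac ((Φ ω).shift (X : E3))) =
      ∫⁻ X in unitCube, g ((Φ ω).shift X) ∂(Φ ω).pointMeasure := by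
    intro g hg ω
    rw [lintegral_sum_measure, setLIntegral_pointMeasure _ _ measurableSet_unitCube]
    simp_rw [lintegral_dirac' _ hg]
  -- Needed for `Measure.bind`, which is the zero measure by default when the family is not a.e.
  -- measurable.
  have hmeas : Measurable fun ω => Measure.sum fun X : ↥((Φ ω).points ∩ unitCube) =>
      Measure.dirac ((Φ ω).shift (X : E3)) := by
    refine Measure.measurable_of_measurable_coe _ fun A hA => ?_
    simp_rw [← lintegral_indicator_one hA, hsum _ (measurable_one.indicator hA)]
    simp_rw [← lintegral_indicator measurableSet_unitCube]
    refine measurable_lintegral_pointMeasure hΦ.measurable ?_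
    have hm : Measurable fun p : Ω × E3 => A.indicator (1 : PointConfig → ℝ≥0∞)
        ((Φ p.1).shift p.2) := (measurable_one.indicator hA).comp
      (measurable_shift.comp (measurable_snd.prodMk (hΦ.measurable.comp measurable_fst)))
    exact hm.indicator (measurable_snd measurableSet_unitCube)
  rw [palmMeasure, lintegral_smul_measure, hΦ.ppIntensity_eq,
    Measure.lintegral_bind hmeas.aemeasurable hf.aemeasurable, smul_eq_mul]
  simp_rw [hsum f hf]

theorem ae_palmMeasure [IsProbabilityMeasure P] (hΦ : IsPoissonPointProcess P r Φ) :
    ∀ᵐ φ ∂palmMeasure P Φ, 0 ∈ φ.points ∧ φ.NoRightAngle := by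
  have h0 : MeasurableSet {φ : PointConfig | 0 ∈ φ.points} := by
    have : {φ : PointConfig | 0 ∈ φ.points} = {φ | φ.count {0} = 0}ᶜ := by
      ext φ
      simp only [Set.mem_ofPred_eq, Set.mem_compl_iff, count_eq_zero, Set.mem_singleton_iff]
      push Not
      simp
    rw [this]
    exact (measurable_count (measurableSet_singleton 0) (measurableSet_singleton 0)).compl
  have hA : MeasurableSet {φ : PointConfig | 0 ∈ φ.points ∧ φ.NoRightAngle} :=
    h0.inter measurableSet_noRightAngle
  rw [ae_iff, ← Set.compl_ofPred, ← lintegral_indicator_one hA.compl,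
    hΦ.lintegral_palmMeasure (measurable_one.indicator hA.compl)]
  have : ∀ᵐ ω ∂P, ∫⁻ X in unitCube,
      {φ : PointConfig | 0 ∈ φ.points ∧ φ.NoRightAngle}ᶜ.indicator (1 : PointConfig → ℝ≥0∞)
        ((Φ ω).shift X) ∂(Φ ω).pointMeasure = 0 := by
    filter_upwards [hΦ.ae_noRightAngle] with ω hω
    rw [setLIntegral_pointMeasure _ _ measurableSet_unitCube, ENNReal.tsum_eq_zero]
    rintro ⟨X, hX, -⟩
    have h0 : 0 ∈ ((Φ ω).shift X).points := by
      rw [mem_points_shift, zero_add]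
      exact hX
    refine Set.indicator_of_notMem ?_ _
    exact Set.notMem_compl_iff.2 ⟨h0, hω.shift X⟩
  rw [lintegral_congr_ae this]
  simp

theorem measure_count_diameterBall_eq_zero (hΦ : IsPoissonPointProcess P r Φ) (X Y : E3) :
    P {ω | (Φ ω).count (diameterBall X Y) = 0} =
      ENNReal.ofReal (Real.exp (-(r * Real.pi / 6 * ‖Y - X‖ ^ 3))) := by
  rw [hΦ.measure_count_eq_zero (C := diameterBall X Y) measurableSet_ball Metric.isBounded_ball,
    diameterBall,
    EuclideanSpace.volume_ball_fin_three, ENNReal.toReal_mul, ENNReal.toReal_pow,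
    ENNReal.toReal_ofReal (by positivity), ENNReal.toReal_ofReal (by positivity), dist_comm,
    dist_eq_norm]
  congr 3
  ring

/-- Mecke's formula is applied to the neighbour `Y`. Adding `Y` does not affect the emptiness of the
ball with diameter `XY`, so the void probability is integrated over `Y`. -/
theorem lintegral_count_gabrielNeighbors [IsProbabilityMeasure P]
    (hΦ : IsPoissonPointProcess P r Φ) (hr : 0 < r) (X : E3) :
    ∫⁻ ω, ((Φ ω).count ((Φ ω).gabrielNeighbors X) : ℝ≥0∞) ∂P = 8 := by
  have hS : MeasurableSet {p : PointConfig × E3 | p.2 ∈ p.1.gabrielNeighbors X} :=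
    ((measurable_const.prodMk measurable_fst).prodMk measurable_snd) measurableSet_gabrielNeighbors
  have h := hΦ.lintegral_lintegral_pointMeasure
    (F := fun φ Y => {p : PointConfig × E3 | p.2 ∈ p.1.gabrielNeighbors X}.indicator 1 (φ, Y))
    (measurable_one.indicator hS)
  have h1 : ∀ φ : PointConfig, ∫⁻ Y, {p : PointConfig × E3 | p.2 ∈ p.1.gabrielNeighbors X}.indicator
      (1 : PointConfig × E3 → ℝ≥0∞) (φ, Y) ∂φ.pointMeasure = φ.count (φ.gabrielNeighbors X) := by
    intro φ
    have hm : MeasurableSet (φ.gabrielNeighbors X) := measurable_prodMk_left (x := φ) hS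
    rw [← pointMeasure_apply _ hm, ← lintegral_indicator_one hm]
    rfl
  have h2 : ∀ᵐ Y : E3, ∫⁻ ω, {p : PointConfig × E3 | p.2 ∈ p.1.gabrielNeighbors X}.indicator
      (1 : PointConfig × E3 → ℝ≥0∞) ((Φ ω).insertPoint Y, Y) ∂P =
        ENNReal.ofReal (Real.exp (-(r * Real.pi / 6 * ‖Y - X‖ ^ 3))) := by
    filter_upwards [measure_eq_zero_iff_ae_notMem.1 (measure_singleton X (μ := volume))] with Y hY
    rw [← hΦ.measure_count_diameterBall_eq_zero, ← lintegral_indicator_one]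
    · refine lintegral_congr fun ω => ?_
      have : Y ∈ ((Φ ω).insertPoint Y).gabrielNeighbors X ↔
          (Φ ω).count (diameterBall X Y) = 0 := by
        rw [gabrielNeighbors, Set.mem_ofPred_eq,
          count_insertPoint_of_notMem (right_notMem_diameterBall X Y)]
        exact and_iff_right hY
      classical
      simp only [Set.indicator_apply, Set.mem_ofPred_eq, this, Pi.one_apply]
    · exact (measurable_count measurableSet_ball).comp hΦ.measurable (measurableSet_singleton 0)
  simp_rw [h1] at h
  rw [h, lintegral_congr_ae h2, lintegral_sub_right_eq_self
    (fun Y : E3 => ENNReal.ofReal (Real.exp (-(r * Real.pi / 6 * ‖Y‖ ^ 3)))) X,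
    lintegral_exp_neg_mul_norm_cube (by positivity), ← ENNReal.ofReal_coe_nnreal,
    ← ENNReal.ofReal_mul (by positivity)]
  have : (r : ℝ) * ((r * Real.pi / 6)⁻¹ * (Real.pi * 4 / 3)) = 8 := by
    have : (r : ℝ) ≠ 0 := by positivity
    field_simp
    norm_num
  rw [this]
  norm_num

/-- Mecke's formula is applied to the nucleus `X` in the unit cube. Each position contributes mean
`8`, and the cube has volume `1`, so the intensity cancels. -/
theorem lintegral_palmMeasure_gabrielNeighbors [IsProbabilityMeasure P]
    (hΦ : IsPoissonPointProcess P r Φ) (hr : 0 < r) :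
    ∫⁻ φ, (φ.count (φ.gabrielNeighbors 0) : ℝ≥0∞) ∂palmMeasure P Φ = 8 := by
  rw [hΦ.lintegral_palmMeasure (f := fun φ => (φ.count (φ.gabrielNeighbors 0) : ℝ≥0∞))
    (measurable_count_gabrielNeighbors.comp (measurable_const.prodMk measurable_id))]
  simp_rw [count_gabrielNeighbors_shift, ← lintegral_indicator measurableSet_unitCube]
  have hF : Measurable (Function.uncurry fun (φ : PointConfig) (X : E3) =>
      unitCube.indicator (fun X => (φ.count (φ.gabrielNeighbors X) : ℝ≥0∞)) X) :=
    (measurable_count_gabrielNeighbors.comp measurable_swap).indicator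
      (measurable_snd measurableSet_unitCube)
  rw [hΦ.lintegral_lintegral_pointMeasure hF]
  have h : ∀ X : E3, ∫⁻ ω, unitCube.indicator (fun X' => ((((Φ ω).insertPoint X).count
      (((Φ ω).insertPoint X).gabrielNeighbors X') : ℕ∞) : ℝ≥0∞)) X ∂P =
        unitCube.indicator (fun _ => 8) X := by
    intro X
    by_cases hX : X ∈ unitCube
    · simp_rw [Set.indicator_of_mem hX, count_gabrielNeighbors_insertPoint]
      exact hΦ.lintegral_count_gabrielNeighbors hr X
    · simp [Set.indicator_of_notMem hX]
  simp_rw [h]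
  rw [lintegral_indicator measurableSet_unitCube, setLIntegral_const, volume_unitCube, mul_one,
    ← mul_assoc, ENNReal.inv_mul_cancel (by exact_mod_cast hr.ne') ENNReal.coe_ne_top, one_mul]

end IsPoissonPointProcess

theorem mainTheorem7 {Ω : Type*} [MeasurableSpace Ω] (P : Measure Ω) [IsProbabilityMeasure P]
    (r : ℝ≥0) (hr : 0 < r) (Φ : Ω → PointConfig) (hΦ : IsPoissonPointProcess P r Φ) :
    AEMeasurable (fun φ : PointConfig => (φ.midpointsInZeroCell : ℝ≥0∞)) (palmMeasure P Φ) ∧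
      ∫⁻ φ, (φ.midpointsInZeroCell : ℝ≥0∞) ∂(palmMeasure P Φ) = 8 := by
  have hae : (fun φ : PointConfig => (φ.midpointsInZeroCell : ℝ≥0∞)) =ᵐ[palmMeasure P Φ]
      fun φ => (φ.count (φ.gabrielNeighbors 0) : ℝ≥0∞) := by
    filter_upwards [hΦ.ae_palmMeasure] with φ hφ
    rw [midpointsInZeroCell_eq hφ.2 hφ.1]
  refine ⟨⟨_, measurable_count_gabrielNeighbors.comp (measurable_const.prodMk measurable_id),
    hae⟩, ?_⟩
  rw [lintegral_congr_ae hae, hΦ.lintegral_palmMeasure_gabrielNeighbors hr]
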